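/- Let $E,F,G$ be Banach spaces over the same field $\mathbb K=\mathbb R$ or $\mathbb C$, let $1<p<\infty$ and $\frac1p+\frac1{p^*}=1$, and let $u\colon E\to F$ and $v\colon F\to G$ be continuous linear operators with adjoints $u^*\colon F^*\to E^*$ and $v^*\colon G^*\to F^*$. For $1\le r<\infty$ and a Banach space $X$ with dual $X^*$, let $\ell_r(X)$ be the set of sequences $(x_j)_{j=1}^\infty$ in $X$ with $\sum_j\|x_j\|^r<\infty$; let $\ell_r^w(X)$ be the set of those with $\sum_j|x^*(x_j)|^r<\infty$ for every $x^*\in X^*$, with norm $\|(x_j)_j\|_{w,r}=\sup_{\|x^*\|\le1}\big(\sum_j|x^*(x_j)|^r\big)^{1/r}$; and let $\ell_r^{mid}(X)$ be the set of $(x_j)_j\in\ell_r^w(X)$ such that $\sum_n\sum_j|x_n^*(x_j)|^r<\infty$ for every $(x_n^*)_n\in\ell_r^w(X^*)$. Let $\ell_p\langle X\rangle$ be the set of sequences $(x_j)_j$ in $X$ with $$\sup\Big\{\sum_j|x_j^*(x_j)| : (x_j^*)_j\in\ell_{p^*}^w(X^*),\ \|(x_j^*)_j\|_{w,p^*}\le1\Big\}<\infty.$$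 A continuous linear operator $T\colon X\to Y$ between Banach spaces is absolutely mid $r$-summing if $(T(x_j))_j\in\ell_r(Y)$ whenever $(x_j)_j\in\ell_r^{mid}(X)$; weakly mid $r$-summing if $(T(x_j))_j\in\ell_r^{mid}(Y)$ whenever $(x_j)_j\in\ell_r^w(X)$; and Cohen strongly $p$-summing if $(T(x_j))_j\in\ell_p\langle Y\rangle$ whenever $(x_j)_j\in\ell_p(X)$. If $u^*$ is absolutely mid $p^*$-summing and $v^*$ is weakly mid $p^*$-summing, then $v\circ u$ is Cohen strongly $p$-summing. -/

import Mathlib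

open scoped ENNReal

noncomputable section

namespace MidSumming

/-- The `ℓ_p` norm `(∑ ‖x_j‖ ^ p) ^ (1 / p)` of a sequence in a normed space, as an element of
`[0, ∞]`; it is finite exactly when the series converges. -/
def seqNorm {E : Type*} [NormedAddCommGroup E] (p : ℝ) (x : ℕ → E) : ℝ≥0∞ :=
  (∑' j, ‖x j‖ₑ ^ p) ^ (1 / p)

/-- `x ∈ ℓ_p(E)`: the sequence `x` is absolutely `p`-summable. -/
def AbsolutelySummable {E : Type*} [NormedAddCommGroup E] (p : ℝ) (x : ℕ → E) : Prop :=
  seqNorm p x < ∞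

variable (𝕜 : Type*) [RCLike 𝕜]

/-- `x ∈ ℓ_p^w(E)`: every `φ ∈ E*` maps `x` to a scalar sequence in `ℓ_p`. -/
def WeaklySummable {E : Type*} [NormedAddCommGroup E] [NormedSpace 𝕜 E]
    (p : ℝ) (x : ℕ → E) : Prop :=
  ∀ φ : StrongDual 𝕜 E, AbsolutelySummable p (fun j => φ (x j))

/-- The norm of `ℓ_p^w(E)`: the supremum of `‖(φ(x_j))_j‖_p` over the closed unit ball of `E*`,
as an element of `[0, ∞]`. -/
def weakNorm {E : Type*} [NormedAddCommGroup E] [NormedSpace 𝕜 E]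
    (p : ℝ) (x : ℕ → E) : ℝ≥0∞ :=
  ⨆ (φ : StrongDual 𝕜 E) (_ : ‖φ‖ ≤ 1), seqNorm p (fun j => φ (x j))

/-- `x ∈ ℓ_p^mid(E)`: the sequence `x` is weakly `p`-summable, and the double sequence
`((ψ_n(x_j))_j)_n` belongs to `ℓ_p(ℓ_p)` for every weakly `p`-summable sequence `ψ` in the
Banach space `E*`. -/
def MidSummable {E : Type*} [NormedAddCommGroup E] [NormedSpace 𝕜 E]
    (p : ℝ) (x : ℕ → E) : Prop :=
  WeaklySummable 𝕜 p x ∧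
    ∀ ψ : ℕ → StrongDual 𝕜 E, WeaklySummable 𝕜 p ψ →
      ∑' n, ∑' j, ‖ψ n (x j)‖ₑ ^ p < ∞

/-- The norm of `ℓ_p⟨E⟩`, as an element of `[0, ∞]`: the supremum of `∑ |ψ_j(x_j)|` over the
closed unit ball of `ℓ_{p*}^w(E*)`, where `1 / p + 1 / p* = 1` (here `1 < p < ∞`). -/
def cohenNorm {E : Type*} [NormedAddCommGroup E] [NormedSpace 𝕜 E]
    (p : ℝ) (x : ℕ → E) : ℝ≥0∞ :=
  ⨆ (ψ : ℕ → StrongDual 𝕜 E)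
    (_ : WeaklySummable 𝕜 p.conjExponent ψ ∧ weakNorm 𝕜 p.conjExponent ψ ≤ 1),
    ∑' j, ‖ψ j (x j)‖ₑ

/-- `x ∈ ℓ_p⟨E⟩`: the sequence `x` is Cohen strongly `p`-summable (here `1 < p < ∞`). -/
def CohenStronglySummable {E : Type*} [NormedAddCommGroup E] [NormedSpace 𝕜 E]
    (p : ℝ) (x : ℕ → E) : Prop :=
  cohenNorm 𝕜 p x < ∞

variable {𝕜}
variable {E F : Type*} [NormedAddCommGroup E] [NormedSpace 𝕜 E]
  [NormedAddCommGroup F] [NormedSpace 𝕜 F]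

/-- `T` maps `ℓ_p^mid(E)` into `ℓ_p(F)`. -/
def IsAbsolutelyMidSumming (p : ℝ) (T : E →L[𝕜] F) : Prop :=
  ∀ x : ℕ → E, MidSummable 𝕜 p x → AbsolutelySummable p (fun j => T (x j))

/-- `T` maps `ℓ_p^w(E)` into `ℓ_p^mid(F)`. -/
def IsWeaklyMidSumming (p : ℝ) (T : E →L[𝕜] F) : Prop :=
  ∀ x : ℕ → E, WeaklySummable 𝕜 p x → MidSummable 𝕜 p (fun j => T (x j))

/-- `T` maps `ℓ_p(E)` into `ℓ_p⟨F⟩` (here `1 < p < ∞`). -/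
def IsCohenStronglySumming (p : ℝ) (T : E →L[𝕜] F) : Prop :=
  ∀ x : ℕ → E, AbsolutelySummable p x → CohenStronglySummable 𝕜 p (fun j => T (x j))

/-- The Banach space adjoint `T* : F* → E*`, `T* φ = φ ∘ T`. -/
def dualOperator (T : E →L[𝕜] F) : StrongDual 𝕜 F →L[𝕜] StrongDual 𝕜 E :=
  ContinuousLinearMap.precomp 𝕜 T

end MidSumming

end

open scoped ENNReal

namespace MidSumming

/-! The adjoint of `v ∘L u` is `u* ∘ v*`: `v*` turns weakly `p*`-summable sequences into mid
`p*`-summable ones, and `u*` turns those into absolutely `p*`-summable ones. Since `ψ_j(T x_j) = (T*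
ψ_j)(x_j)`, Young's inequality makes `∑ |ψ_j(T x_j)|` finite for each weakly `p*`-summable `ψ`. The
Cohen norm needs a bound uniform in `ψ`; `cohenStronglySummable_of_forall` supplies it by gluing a
hypothetical unbounded family of `ψ` into a single weakly summable sequence. -/

theorem absolutelySummable_iff {E : Type*} [NormedAddCommGroup E] {p : ℝ} (hp : 0 < p)
    {x : ℕ → E} : AbsolutelySummable p x ↔ ∑' j, ‖x j‖ₑ ^ p < ∞ := by
  unfold AbsolutelySummable seqNorm
  exact ENNReal.rpow_lt_top_iff_of_pos (one_div_pos.2 hp)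

section WeakNorm

variable {𝕜 : Type*} [RCLike 𝕜] {E : Type*} [NormedAddCommGroup E] [NormedSpace 𝕜 E]

theorem tsum_enorm_rpow_le_one {p : ℝ} (hp : 0 < p) {x : ℕ → E} (hx : weakNorm 𝕜 p x ≤ 1)
    {φ : StrongDual 𝕜 E} (hφ : ‖φ‖ ≤ 1) : ∑' j, ‖φ (x j)‖ₑ ^ p ≤ 1 := by
  have h : seqNorm p (fun j => φ (x j)) ≤ 1 :=
    (le_iSup₂ (f := fun (φ : StrongDual 𝕜 E) (_ : ‖φ‖ ≤ 1) =>
      seqNorm p (fun j => φ (x j))) φ hφ).trans hx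
  unfold seqNorm at h
  rwa [← ENNReal.one_rpow (1 / p), ENNReal.rpow_le_rpow_iff (one_div_pos.2 hp)] at h

theorem tsum_enorm_rpow_le {p : ℝ} (hp : 0 < p) {x : ℕ → E} (hx : weakNorm 𝕜 p x ≤ 1)
    (φ : StrongDual 𝕜 E) : ∑' j, ‖φ (x j)‖ₑ ^ p ≤ (‖φ‖ₑ + 1) ^ p := by
  -- The extra `1` keeps the normalising scalar nonzero even when `φ = 0`.
  set c : 𝕜 := ((‖φ‖ + 1 : ℝ) : 𝕜) with hc
  have hpos : 0 < ‖φ‖ + 1 := by positivity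
  have hc0 : c ≠ 0 := by rw [hc]; exact_mod_cast hpos.ne'
  have hcn : ‖c‖ = ‖φ‖ + 1 := by rw [hc, RCLike.norm_ofReal, abs_of_pos hpos]
  have hce : ‖c‖ₑ = ‖φ‖ₑ + 1 := by
    rw [← ofReal_norm, hcn, ENNReal.ofReal_add (norm_nonneg _) zero_le_one, ofReal_norm,
      ENNReal.ofReal_one]
  have hφ : ‖c⁻¹ • φ‖ ≤ 1 := by
    rw [norm_smul, norm_inv, hcn, inv_mul_le_one₀ hpos]
    linarith
  calc ∑' j, ‖φ (x j)‖ₑ ^ p = ∑' j, ‖c‖ₑ ^ p * ‖(c⁻¹ • φ) (x j)‖ₑ ^ p := by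
        refine tsum_congr fun j => ?_
        rw [← ENNReal.mul_rpow_of_nonneg _ _ hp.le, ← enorm_smul]
        simp [hc0]
    _ = ‖c‖ₑ ^ p * ∑' j, ‖(c⁻¹ • φ) (x j)‖ₑ ^ p := ENNReal.tsum_mul_left
    _ ≤ ‖c‖ₑ ^ p * 1 := by gcongr; exact tsum_enorm_rpow_le_one hp hx hφ
    _ = (‖φ‖ₑ + 1) ^ p := by rw [mul_one, hce]

/-- A diagonal choice from a sequence in the unit ball of `ℓ_p^w(E)`, weighted by `2⁻ᵏ`,
is weakly `p`-summable. -/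
theorem weaklySummable_diagonal {p : ℝ} (hp : 1 ≤ p) {x : ℕ → ℕ → E}
    (hx : ∀ k, weakNorm 𝕜 p (x k) ≤ 1) (κ : ℕ → ℕ) :
    WeaklySummable 𝕜 p (fun j => ((2 : 𝕜)⁻¹ ^ κ j) • x (κ j) j) := by
  intro φ
  have hp0 : 0 < p := by linarith
  rw [absolutelySummable_iff hp0]
  have h2 : ‖(2 : 𝕜)⁻¹‖ₑ = 2⁻¹ := by
    rw [enorm_inv two_ne_zero, ← ofReal_norm, RCLike.norm_ofNat]; simp
  calc ∑' j, ‖φ (((2 : 𝕜)⁻¹ ^ κ j) • x (κ j) j)‖ₑ ^ p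
      = ∑' j, ((2⁻¹ : ℝ≥0∞) ^ κ j) ^ p * ‖φ (x (κ j) j)‖ₑ ^ p := by
        refine tsum_congr fun j => ?_
        rw [map_smul, enorm_smul, enorm_pow, h2, ENNReal.mul_rpow_of_nonneg _ _ hp0.le]
    -- Adding all other indices `k` removes the dependence on `κ`, which is arbitrary.
    _ ≤ ∑' j, ∑' k, ((2⁻¹ : ℝ≥0∞) ^ k) ^ p * ‖φ (x k j)‖ₑ ^ p :=
        ENNReal.tsum_le_tsum fun j =>
          ENNReal.le_tsum (f := fun k => ((2⁻¹ : ℝ≥0∞) ^ k) ^ p * ‖φ (x k j)‖ₑ ^ p) (κ j)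
    _ = ∑' k, ((2⁻¹ : ℝ≥0∞) ^ k) ^ p * ∑' j, ‖φ (x k j)‖ₑ ^ p := by
        rw [ENNReal.tsum_comm]
        exact tsum_congr fun k => ENNReal.tsum_mul_left
    _ ≤ ∑' k, (2⁻¹ : ℝ≥0∞) ^ k * (‖φ‖ₑ + 1) ^ p := by
        refine ENNReal.tsum_le_tsum fun k => mul_le_mul' ?_ (tsum_enorm_rpow_le hp0 (hx k) φ)
        exact ENNReal.rpow_le_self_of_le_one
          (pow_le_one₀ zero_le (ENNReal.inv_le_one.2 one_le_two)) hp
    _ = 2 * (‖φ‖ₑ + 1) ^ p := by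
        rw [ENNReal.tsum_mul_right, ENNReal.tsum_geometric, ENNReal.one_sub_inv_two, inv_inv]
    _ < ∞ := ENNReal.mul_lt_top (by simp)
        (ENNReal.rpow_lt_top_of_nonneg hp0.le (by simp [enorm_ne_top]))

/-- Evaluation at `y` is a functional on the dual, and one term is at most the whole sum. The bound
does not depend on `ψ`, so suprema over the unit ball are finite at each fixed `j`. -/
theorem enorm_apply_le_of_weakNorm_le_one {p : ℝ} (hp : 0 < p) {ψ : ℕ → StrongDual 𝕜 E}
    (hψ : weakNorm 𝕜 p ψ ≤ 1) (y : E) (j : ℕ) :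
    ‖ψ j y‖ₑ ≤ ‖ContinuousLinearMap.apply 𝕜 𝕜 y‖ₑ + 1 := by
  have h := (ENNReal.le_tsum j).trans
    (tsum_enorm_rpow_le hp hψ (ContinuousLinearMap.apply 𝕜 𝕜 y))
  rwa [ENNReal.rpow_le_rpow_iff hp, ContinuousLinearMap.apply_apply] at h

/-- Pointwise finiteness of the sums defining the norm of `ℓ_p⟨E⟩` implies their
boundedness on the unit ball of `ℓ_{p*}^w(E*)`. -/
theorem cohenStronglySummable_of_forall {p : ℝ} (hp : 1 ≤ p.conjExponent) {y : ℕ → E}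
    (h : ∀ ψ : ℕ → StrongDual 𝕜 E, WeaklySummable 𝕜 p.conjExponent ψ →
      ∑' j, ‖ψ j (y j)‖ₑ < ∞) :
    CohenStronglySummable 𝕜 p y := by
  have hp0 : 0 < p.conjExponent := by linarith
  by_contra hcon
  have htop : cohenNorm 𝕜 p y = ∞ := not_lt_top_iff.1 hcon
  have hex : ∀ k : ℕ, ∃ ψ : ℕ → StrongDual 𝕜 E, weakNorm 𝕜 p.conjExponent ψ ≤ 1 ∧
      (4 : ℝ≥0∞) ^ k < ∑' j, ‖ψ j (y j)‖ₑ := by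
    intro k
    have hlt : (4 : ℝ≥0∞) ^ k < cohenNorm 𝕜 p y := by
      rw [htop]; exact ENNReal.pow_lt_top (by simp)
    unfold cohenNorm at hlt
    obtain ⟨ψ, hψ⟩ := lt_iSup_iff.1 hlt
    obtain ⟨hψ', hψ⟩ := lt_iSup_iff.1 hψ
    exact ⟨ψ, hψ'.2, hψ⟩
  choose ψ hball hbig using hex
  let a : ℕ → ℕ → ℝ≥0∞ := fun k j => (2⁻¹ : ℝ≥0∞) ^ k * ‖ψ k j (y j)‖ₑ
  -- The supremum over `i` need not be attained, but when it is positive and finite some index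
  -- exceeds half of it.
  have hκ : ∀ j, ∃ k, ∀ i, a i j ≤ 2 * a k j := by
    intro j
    have hfin : ⨆ i, a i j ≠ ∞ := by
      refine ne_top_of_le_ne_top
        (b := ‖ContinuousLinearMap.apply 𝕜 𝕜 (y j)‖ₑ + 1) (by simp [enorm_ne_top])
        (iSup_le fun i => ?_)
      exact (mul_le_of_le_one_left' (pow_le_one₀ zero_le
        (ENNReal.inv_le_one.2 one_le_two))).trans
        (enorm_apply_le_of_weakNorm_le_one hp0 (hball i) (y j) j)
    by_cases h0 : ⨆ i, a i j = 0
    · exact ⟨0, fun i => by rw [ENNReal.iSup_eq_zero.1 h0 i]; exact zero_le⟩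
    · obtain ⟨k, hk⟩ := lt_iSup_iff.1 (ENNReal.half_lt_self h0 hfin)
      refine ⟨k, fun i => (le_iSup (fun i => a i j) i).trans ?_⟩
      rw [mul_comm]
      exact (ENNReal.div_le_iff (by simp) (by simp)).1 hk.le
  choose κ hκ using hκ
  have hsum := h _ (weaklySummable_diagonal hp hball κ)
  have h2 : ‖(2 : 𝕜)⁻¹‖ₑ = 2⁻¹ := by
    rw [enorm_inv two_ne_zero, ← ofReal_norm, RCLike.norm_ofNat]; simp
  have heq : ∑' j, ‖(((2 : 𝕜)⁻¹ ^ κ j) • ψ (κ j) j) (y j)‖ₑ = ∑' j, a (κ j) j := by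
    refine tsum_congr fun j => ?_
    rw [smul_apply, enorm_smul, enorm_pow, h2]
  rw [heq] at hsum
  -- The growth `4 ^ k` beats the weight `2⁻ᵏ`, and the glued sequence dominates every weighted row
  -- up to the factor `2`, so its finite sum would exceed every power of `2` up to that factor.
  have hle : ∀ k : ℕ, (2 : ℝ≥0∞) ^ k ≤ 2 * ∑' j, a (κ j) j := fun k =>
    calc (2 : ℝ≥0∞) ^ k = (2⁻¹ : ℝ≥0∞) ^ k * 4 ^ k := by
          rw [show (4 : ℝ≥0∞) = 2 * 2 by norm_num, ← mul_pow, ← mul_assoc,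
            ENNReal.inv_mul_cancel (by simp) (by simp), one_mul]
      _ ≤ (2⁻¹ : ℝ≥0∞) ^ k * ∑' j, ‖ψ k j (y j)‖ₑ := by gcongr; exact (hbig k).le
      _ = ∑' j, a k j := ENNReal.tsum_mul_left.symm
      _ ≤ ∑' j, 2 * a (κ j) j := ENNReal.tsum_le_tsum fun j => hκ j k
      _ = 2 * ∑' j, a (κ j) j := ENNReal.tsum_mul_left
  obtain ⟨n, hn⟩ := ENNReal.exists_nat_gt (ENNReal.mul_ne_top (a := 2) ENNReal.ofNat_ne_top hsum.ne)
  refine absurd ((hle n).trans_lt hn) (not_lt.2 ?_)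
  exact_mod_cast (Nat.lt_two_pow_self (n := n)).le

end WeakNorm

variable {𝕜 : Type*} [RCLike 𝕜] {E F : Type*} [NormedAddCommGroup E] [NormedSpace 𝕜 E]
  [NormedAddCommGroup F] [NormedSpace 𝕜 F]

theorem tsum_enorm_apply_lt_top {p q : ℝ} (hpq : p.HolderConjugate q)
    {x : ℕ → E} (hx : AbsolutelySummable p x)
    {φ : ℕ → StrongDual 𝕜 E} (hφ : AbsolutelySummable q φ) :
    ∑' j, ‖φ j (x j)‖ₑ < ∞ := by
  rw [absolutelySummable_iff hpq.pos] at hx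
  rw [absolutelySummable_iff hpq.symm.pos] at hφ
  calc ∑' j, ‖φ j (x j)‖ₑ
      -- Only finiteness is needed, so termwise Young replaces Hölder.
      ≤ ∑' j, (‖φ j‖ₑ ^ q * (ENNReal.ofReal q)⁻¹ + ‖x j‖ₑ ^ p * (ENNReal.ofReal p)⁻¹) :=
        ENNReal.tsum_le_tsum fun j => ((φ j).le_opENorm (x j)).trans
          (by simpa only [div_eq_mul_inv] using ENNReal.young_inequality _ _ hpq.symm)
    _ = (∑' j, ‖φ j‖ₑ ^ q) * (ENNReal.ofReal q)⁻¹ + (∑' j, ‖x j‖ₑ ^ p) * (ENNReal.ofReal p)⁻¹ := by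
        rw [ENNReal.tsum_add, ENNReal.tsum_mul_right, ENNReal.tsum_mul_right]
    _ < ∞ := ENNReal.add_lt_top.2
        ⟨ENNReal.mul_lt_top hφ (by simp [hpq.symm.pos]),
          ENNReal.mul_lt_top hx (by simp [hpq.pos])⟩

/-- An operator is Cohen strongly `p`-summing if its adjoint is absolutely `p*`-summing. -/
theorem isCohenStronglySumming_of_dualOperator {p : ℝ} (hp : 1 < p) {T : E →L[𝕜] F}
    (hT : ∀ ψ : ℕ → StrongDual 𝕜 F, WeaklySummable 𝕜 p.conjExponent ψ →
      AbsolutelySummable p.conjExponent (fun j => dualOperator T (ψ j))) :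
    IsCohenStronglySumming p T := by
  have hpq := Real.HolderConjugate.conjExponent hp
  exact fun x hx => cohenStronglySummable_of_forall hpq.symm.lt.le fun ψ hψ =>
    tsum_enorm_apply_lt_top hpq hx (hT ψ hψ)

theorem dualOperator_comp_apply {G : Type*} [NormedAddCommGroup G] [NormedSpace 𝕜 G]
    (v : F →L[𝕜] G) (u : E →L[𝕜] F) (φ : StrongDual 𝕜 G) :
    dualOperator (v ∘L u) φ = dualOperator u (dualOperator v φ) := by
  ext x
  rfl

end MidSumming

theorem corollary2p9 {𝕜 : Type*} [RCLike 𝕜]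
    {E F G : Type*}
    [NormedAddCommGroup E] [NormedSpace 𝕜 E] [CompleteSpace E]
    [NormedAddCommGroup F] [NormedSpace 𝕜 F] [CompleteSpace F]
    [NormedAddCommGroup G] [NormedSpace 𝕜 G] [CompleteSpace G]
    (p : ℝ) (hp : 1 < p) (u : E →L[𝕜] F) (v : F →L[𝕜] G)
    (hu : MidSumming.IsAbsolutelyMidSumming p.conjExponent (MidSumming.dualOperator u))
    (hv : MidSumming.IsWeaklyMidSumming p.conjExponent (MidSumming.dualOperator v)) :
    MidSumming.IsCohenStronglySumming p (v ∘L u) := by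
  refine MidSumming.isCohenStronglySumming_of_dualOperator hp fun ψ hψ => ?_
  simp only [MidSumming.dualOperator_comp_apply]
  exact hu _ (hv ψ hψ)
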